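/- **Definitions.** Fix countably many propositional variables. Superintuitionistic modal formulae ($\sim$-formulae) are built from variables, $\bot,\top,\land,\lor,\to,\boxtimes$. Classical modal formulae ($\mathit{clm}$-formulae) are built from variables, $\bot,\top,\land,\neg,\square$, with $\lor,\to$ the usual abbreviations and $\square^+\varphi:=\square\varphi\land\varphi$. For either language, a rule $\Gamma/\Delta$ is a pair of finite (possibly empty) sets of formulae. A rule system is a set $\mathsf S$ of rules such that: - if $\Gamma/\Delta\in\mathsf S$, then $s[\Gamma]/s[\Delta]\in\mathsf S$ for every substitution $s$; - $\varphi/\varphi\in\mathsf S$ for every formula $\varphi$; - if $\Gamma/\Delta\in\mathsf S$, then $\Gamma\cup\Gamma'/\Delta\cup\Delta'\in\mathsf S$ for all finite $\Gamma',\Delta'$; - if $\Gamma/\Delta\cup\{\varphi\}\in\mathsf S$ and $\Gamma\cup\{\varphi\}/\Delta\in\mathsf S$, then $\Gamma/\Delta\in\mathsf S$; - $\varphi,\varphi\to\psi/\psi\in\mathsf S$ for all formulae $\varphi,\psi$; - $\varphi/\boxtimes\varphi\in\mathsf S$ for every $\sim$-formula $\varphi$ (respectively $\varphi/\square\varphi\in\mathsf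 S$ for every $\mathit{clm}$-formula $\varphi$). Rule systems are ordered by inclusion. $\mathsf{NExt}(\mathsf S)$ is the set of rule systems (in the same language) that contain $\mathsf S$, and $X\oplus Y$ is the least rule system containing the sets of rules $X$ and $Y$. - $\mathsf{mHC}$ is the least $\sim$-rule system containing $/\varphi$ for every theorem $\varphi$ of the intuitionistic propositional calculus and the rules $/\boxtimes(p\to q)\to(\boxtimes p\to\boxtimes q)$, $/p\to\boxtimes p$ and $/\boxtimes p\to(q\lor(q\to p))$. - $\mathsf{K4}$ is the least $\mathit{clm}$-rule system containing $/\varphi$ for every $\varphi$ valid in all transitive Kripke frames. - $\mathsf{K4.Grz}:=\mathsf{K4}\oplus\{/\square(\square(p\to\square p)\to p)\to\square p\}$. The translation $T$ from $\sim$-formulae to $\mathit{clm}$-formulae is given by $T(p)=\square^+p$ for variables $p$, $T(\bot)=\bot$, $T(\top)=\top$, $T(\varphi\land\psi)=T(\varphi)\land T(\psi)$, $T(\varphi\lor\psi)=T(\varphi)\lor T(\psi)$, $T(\varphi\to\psi)=\square^+(\neg T(\varphi)\lor T(\psi))$, $T(\boxtimes\varphi)=\square T(\varphi)$, and for rules by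 $T(\Gamma/\Delta)=T[\Gamma]/T[\Delta]$. For $\mathsf L\in\mathsf{NExt}(\mathsf{mHC})$ and $\mathsf M\in\mathsf{NExt}(\mathsf{K4})$ let $$\tau\mathsf L:=\mathsf{K4}\oplus\{T(\Gamma/\Delta):\Gamma/\Delta\in\mathsf L\},\qquad \sigma\mathsf L:=\mathsf{K4.Grz}\oplus\tau\mathsf L,\qquad \rho\mathsf M:=\{\Gamma/\Delta: T(\Gamma/\Delta)\in\mathsf M\}.$$ $\mathsf M$ is a *monomodal companion* of $\mathsf L$ if $\mathsf M\in\mathsf{NExt}(\mathsf{K4})$ and $\mathsf L=\rho\mathsf M$. **Theorem (Interval theorem).** Let $\mathsf L\in\mathsf{NExt}(\mathsf{mHC})$. The monomodal companions of $\mathsf L$ form an interval in $\mathsf{NExt}(\mathsf{K4})$ with least element $\tau\mathsf L$ and greatest element $\sigma\mathsf L$. That is, both $\tau\mathsf L$ and $\sigma\mathsf L$ are monomodal companions of $\mathsf L$, and a $\mathit{clm}$-rule system $\mathsf M$ is a monomodal companion of $\mathsf L$ if and only if $\tau\mathsf L\subseteq\mathsf M\subseteq\sigma\mathsf L$. -/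

import Mathlib

namespace IntervalThm

/-- Superintuitionistic modal formulae; the propositional variables are indexed by `ℕ`. -/
inductive SimFrm : Type
  | var : ℕ → SimFrm
  | bot : SimFrm
  | top : SimFrm
  | and : SimFrm → SimFrm → SimFrm
  | or : SimFrm → SimFrm → SimFrm
  | imp : SimFrm → SimFrm → SimFrm
  | box : SimFrm → SimFrm
  deriving DecidableEq

/-- Classical modal formulae. -/
inductive ClmFrm : Type
  | var : ℕ → ClmFrm
  | bot : ClmFrm
  | top : ClmFrm
  | and : ClmFrm → ClmFrm → ClmFrm
  | neg : ClmFrm → ClmFrm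
  | box : ClmFrm → ClmFrm
  deriving DecidableEq

/-- The classical abbreviation `φ ∨ ψ := ¬(¬φ ∧ ¬ψ)`. -/
def ClmFrm.or (φ ψ : ClmFrm) : ClmFrm := .neg (.and (.neg φ) (.neg ψ))

/-- The classical abbreviation `φ → ψ := ¬(φ ∧ ¬ψ)`. -/
def ClmFrm.imp (φ ψ : ClmFrm) : ClmFrm := .neg (.and φ (.neg ψ))

/-- The abbreviation `□⁺φ := □φ ∧ φ`. -/
def ClmFrm.boxPlus (φ : ClmFrm) : ClmFrm := .and (.box φ) φ

/-- The extension of `s` to the map on formulae commuting with all connectives. -/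
def SimFrm.subst (s : ℕ → SimFrm) : SimFrm → SimFrm
  | .var n => s n
  | .bot => .bot
  | .top => .top
  | .and φ ψ => .and (φ.subst s) (ψ.subst s)
  | .or φ ψ => .or (φ.subst s) (ψ.subst s)
  | .imp φ ψ => .imp (φ.subst s) (ψ.subst s)
  | .box φ => .box (φ.subst s)

/-- The extension of `s` to the map on formulae commuting with all connectives. -/
def ClmFrm.subst (s : ℕ → ClmFrm) : ClmFrm → ClmFrm
  | .var n => s n
  | .bot => .bot
  | .top => .top
  | .and φ ψ => .and (φ.subst s) (ψ.subst s)
  | .neg φ => .neg (φ.subst s)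
  | .box φ => .box (φ.subst s)

/-- The data on a type of formulae that the notion of rule system refers to. It is used only for
`SimFrm` and `ClmFrm`, through the two instances below. -/
class ModalLanguage (F : Type) where
  subst : (ℕ → F) → F → F
  imp : F → F → F
  box : F → F

instance : ModalLanguage SimFrm := ⟨SimFrm.subst, SimFrm.imp, SimFrm.box⟩

instance : ModalLanguage ClmFrm := ⟨ClmFrm.subst, ClmFrm.imp, ClmFrm.box⟩

/-- A multi-conclusion rule `Γ/Δ`: a pair of finite sets of formulae. -/
abbrev Rule (F : Type) : Type := Finset F × Finset F

/-- The assumption-free rule `/φ`. -/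
def axiomRule {F : Type} (φ : F) : Rule F := (∅, {φ})

section RuleSystems

variable {F : Type} [DecidableEq F] [ModalLanguage F]

/-- The closure conditions defining rule systems. -/
structure IsRuleSystem (S : Set (Rule F)) : Prop where
  structurality : ∀ (s : ℕ → F) (Γ Δ : Finset F), (Γ, Δ) ∈ S →
    (Γ.image (ModalLanguage.subst s), Δ.image (ModalLanguage.subst s)) ∈ S
  reflexivity : ∀ φ : F, ({φ}, {φ}) ∈ S
  monotonicity : ∀ Γ Δ Γ' Δ' : Finset F, (Γ, Δ) ∈ S → (Γ ∪ Γ', Δ ∪ Δ') ∈ S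
  cut : ∀ (Γ Δ : Finset F) (φ : F),
    (Γ, insert φ Δ) ∈ S → (insert φ Γ, Δ) ∈ S → (Γ, Δ) ∈ S
  modusPonens : ∀ φ ψ : F, ({φ, ModalLanguage.imp φ ψ}, {ψ}) ∈ S
  necessitation : ∀ φ : F, ({φ}, {ModalLanguage.box φ}) ∈ S

variable (F) in
/-- Rule systems over the language `F`, ordered by inclusion. -/
abbrev RuleSystem : Type := {S : Set (Rule F) // IsRuleSystem S}

/-- The least rule system containing a given set of rules. -/
def generate (X : Set (Rule F)) : RuleSystem F :=
  ⟨{r | ∀ S : Set (Rule F), IsRuleSystem S → X ⊆ S → r ∈ S},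
    { structurality := fun s Γ Δ h S hS hX => hS.structurality s Γ Δ (h S hS hX)
      reflexivity := fun φ _ hS _ => hS.reflexivity φ
      monotonicity := fun Γ Δ Γ' Δ' h S hS hX => hS.monotonicity Γ Δ Γ' Δ' (h S hS hX)
      cut := fun Γ Δ φ h₁ h₂ S hS hX => hS.cut Γ Δ φ (h₁ S hS hX) (h₂ S hS hX)
      modusPonens := fun φ ψ _ hS _ => hS.modusPonens φ ψ
      necessitation := fun φ _ hS _ => hS.necessitation φ }⟩

theorem subset_generate (X : Set (Rule F)) : X ⊆ (generate X).1 :=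
  fun _ hr _ _ hX => hX hr

theorem generate_le {X : Set (Rule F)} {S : RuleSystem F} (h : X ⊆ S.1) : generate X ≤ S :=
  fun _ hr => hr S.1 S.2 h

/-- `oplus X Y` is the least rule system containing the sets of rules `X` and `Y`. -/
def oplus (X Y : Set (Rule F)) : RuleSystem F := generate (X ∪ Y)

/-- The rule systems extending `S`. -/
def NExt (S : RuleSystem F) : Set (RuleSystem F) := {S' | S ≤ S'}

end RuleSystems

/-- Theoremhood in the intuitionistic propositional calculus (a Hilbert calculus, formulated in the
language `SimFrm`: formulae `⊠φ` behave as atoms). -/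
inductive IPC : SimFrm → Prop
  | k (φ ψ : SimFrm) : IPC (.imp φ (.imp ψ φ))
  | s (φ ψ χ : SimFrm) :
      IPC (.imp (.imp φ (.imp ψ χ)) (.imp (.imp φ ψ) (.imp φ χ)))
  | andLeft (φ ψ : SimFrm) : IPC (.imp (.and φ ψ) φ)
  | andRight (φ ψ : SimFrm) : IPC (.imp (.and φ ψ) ψ)
  | andIntro (φ ψ : SimFrm) : IPC (.imp φ (.imp ψ (.and φ ψ)))
  | orLeft (φ ψ : SimFrm) : IPC (.imp φ (.or φ ψ))
  | orRight (φ ψ : SimFrm) : IPC (.imp ψ (.or φ ψ))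
  | orElim (φ ψ χ : SimFrm) :
      IPC (.imp (.imp φ χ) (.imp (.imp ψ χ) (.imp (.or φ ψ) χ)))
  | botElim (φ : SimFrm) : IPC (.imp .bot φ)
  | topIntro : IPC .top
  | mp (φ ψ : SimFrm) : IPC (.imp φ ψ) → IPC φ → IPC ψ

/-- The modalized Heyting calculus `mHC`. -/
def mHC : RuleSystem SimFrm :=
  generate ({r | ∃ φ, IPC φ ∧ r = axiomRule φ} ∪
    {axiomRule (.imp (.box (.imp (.var 0) (.var 1)))
        (.imp (.box (.var 0)) (.box (.var 1)))),
     axiomRule (.imp (.var 0) (.box (.var 0))),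
     axiomRule (.imp (.box (.var 0)) (.or (.var 1) (.imp (.var 1) (.var 0))))})

/-- Truth of a classical modal formula at a world of a Kripke model. -/
def Sat {W : Type} (R : W → W → Prop) (V : ℕ → Set W) : W → ClmFrm → Prop
  | w, .var n => w ∈ V n
  | _, .bot => False
  | _, .top => True
  | w, .and φ ψ => Sat R V w φ ∧ Sat R V w ψ
  | w, .neg φ => ¬ Sat R V w φ
  | w, .box φ => ∀ v, R w v → Sat R V v φ

/-- Validity in all transitive Kripke frames. -/
def TransValid (φ : ClmFrm) : Prop :=
  ∀ (W : Type) (R : W → W → Prop), (∀ x y z, R x y → R y z → R x z) →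
    ∀ (V : ℕ → Set W) (w : W), Sat R V w φ

/-- The rule system `K4`. -/
def K4 : RuleSystem ClmFrm := generate {r | ∃ φ, TransValid φ ∧ r = axiomRule φ}

/-- The axiom `□(□(p → □p) → p) → □p` of `K4.Grz`. -/
def grzAxiom : ClmFrm :=
  .imp (.box (.imp (.box (.imp (.var 0) (.box (.var 0)))) (.var 0))) (.box (.var 0))

/-- The rule system `K4.Grz`. -/
def K4Grz : RuleSystem ClmFrm := oplus K4.1 {axiomRule grzAxiom}

/-- The translation `T` of superintuitionistic modal formulae into classical ones. -/
def T : SimFrm → ClmFrm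
  | .var n => .boxPlus (.var n)
  | .bot => .bot
  | .top => .top
  | .and φ ψ => .and (T φ) (T ψ)
  | .or φ ψ => .or (T φ) (T ψ)
  | .imp φ ψ => .boxPlus (.or (.neg (T φ)) (T ψ))
  | .box φ => .box (T φ)

/-- `T(Γ/Δ) := T[Γ]/T[Δ]`. -/
def TRule (r : Rule SimFrm) : Rule ClmFrm := (r.1.image T, r.2.image T)

/-- `τL := K4 ⊕ {T(Γ/Δ) : Γ/Δ ∈ L}`. -/
def tau (L : RuleSystem SimFrm) : RuleSystem ClmFrm := oplus K4.1 (TRule '' L.1)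

/-- `σL := K4.Grz ⊕ τL`. -/
def sigma (L : RuleSystem SimFrm) : RuleSystem ClmFrm := oplus K4Grz.1 (tau L).1

/-- `ρM := {Γ/Δ : T(Γ/Δ) ∈ M}`. -/
def rho (M : RuleSystem ClmFrm) : Set (Rule SimFrm) := {r | TRule r ∈ M.1}

/-- `M` is a monomodal companion of `L`: `M` extends `K4` and `L = ρM`. -/
def IsMonomodalCompanion (M : RuleSystem ClmFrm) (L : RuleSystem SimFrm) : Prop :=
  M ∈ NExt K4 ∧ L.1 = rho M

end IntervalThm

/-! For a companion `M` of `L`, `τL ⊆ M` is formal, and so is `L ⊆ ρM` once `τL ⊆ M`. Two facts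
carry the theorem.

Faithfulness (`rho_sigma_subset`). On the prime theories of `L`, the axioms of `mHC` make inclusion
the reflexive closure of the canonical relation, so translated formulae are evaluated
intuitionistically. Valuations are restricted to the Boolean algebra generated by the extents: its
members have definable interiors and, by Zorn, maximal points, so the Grzegorczyk axiom holds. To
reach rules and not only theorems, a `clm`-formula is evaluated to a `∼`-formula (`Canon.value`);
the rules whose values always lie in `L` form a rule system (`canonRules`) containing `σL`.

Maximality (`le_sigma`). After substituting Boolean combinations of translated formulae for the
variables, every formula is interderivable over `K4` with a translated one, so a rule of `M` lands
in `τL` (`subst_rule_mem_tau`). Such a substitution can be undone in the presence of Grz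
(`exists_substitution`). Colour points by their types over a finite subformula-closed set. By Grz,
every non-final point sees a final point of the same type. Final types are recognised by
`□⁺`-formulae; any other point may be recoloured by a visible type whose boxed formulae agree with
everything visible, without changing which formulae of the set are globally true. -/

namespace IntervalThm

/-! ### Derived rules of rule systems -/

section RuleSystems

variable {F : Type} [DecidableEq F] [ModalLanguage F] {S : Set (Rule F)}

theorem IsRuleSystem.weaken (hS : IsRuleSystem S) {Γ Δ Γ' Δ' : Finset F} (h : (Γ, Δ) ∈ S)
    (hΓ : Γ ⊆ Γ') (hΔ : Δ ⊆ Δ') : (Γ', Δ') ∈ S := by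
  have := hS.monotonicity Γ Δ Γ' Δ' h
  rwa [Finset.union_eq_right.2 hΓ, Finset.union_eq_right.2 hΔ] at this

theorem IsRuleSystem.assumption (hS : IsRuleSystem S) {Γ Δ : Finset F} {φ : F} (h : φ ∈ Γ)
    (h' : φ ∈ Δ) : (Γ, Δ) ∈ S :=
  hS.weaken (hS.reflexivity φ) (by simpa using h) (by simpa using h')

/-- Cut on finitely many derivable premises. -/
theorem IsRuleSystem.cut_premises (hS : IsRuleSystem S) {Γ Γ' Δ : Finset F}
    (h : (Γ ∪ Γ', Δ) ∈ S) (hΓ : ∀ γ ∈ Γ, (Γ', {γ}) ∈ S) : (Γ', Δ) ∈ S := by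
  induction Γ using Finset.induction_on with
  | empty => simpa using h
  | insert γ Γ _ ih =>
    refine ih (hS.cut _ _ γ ?_ (by rwa [← Finset.insert_union]))
      fun γ' hγ' => hΓ γ' (Finset.mem_insert_of_mem hγ')
    exact hS.weaken (hΓ γ (Finset.mem_insert_self _ _)) Finset.subset_union_right (by simp)

/-- Cut on finitely many conclusions. -/
theorem IsRuleSystem.cut_conclusions (hS : IsRuleSystem S) {Γ Δ Δ' : Finset F}
    (h : (Γ, Δ ∪ Δ') ∈ S) (hΔ : ∀ δ ∈ Δ, (insert δ Γ, Δ') ∈ S) : (Γ, Δ') ∈ S := by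
  induction Δ using Finset.induction_on with
  | empty => simpa using h
  | insert δ Δ _ ih =>
    refine ih (hS.cut _ _ δ (by rwa [← Finset.insert_union]) ?_)
      fun δ' hδ' => hΔ δ' (Finset.mem_insert_of_mem hδ')
    exact hS.weaken (hΔ δ (Finset.mem_insert_self _ _)) subset_rfl Finset.subset_union_right

theorem IsRuleSystem.trans (hS : IsRuleSystem S) {Γ Δ Γ' Δ' : Finset F} (h : (Γ, Δ) ∈ S)
    (hΓ : ∀ γ ∈ Γ, (Γ', {γ}) ∈ S) (hΔ : ∀ δ ∈ Δ, (insert δ Γ', Δ') ∈ S) : (Γ', Δ') ∈ S :=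
  hS.cut_conclusions (Δ := Δ) (hS.cut_premises
    (hS.weaken h Finset.subset_union_left Finset.subset_union_left) hΓ) hΔ

theorem IsRuleSystem.mp (hS : IsRuleSystem S) {Γ : Finset F} {φ ψ : F}
    (h : (Γ, {ModalLanguage.imp φ ψ}) ∈ S) (h' : (Γ, {φ}) ∈ S) : (Γ, {ψ}) ∈ S :=
  hS.trans (hS.modusPonens φ ψ) (by simp [h, h'])
    (by simpa using hS.assumption (φ := ψ) (by simp) (by simp))

theorem IsRuleSystem.nec (hS : IsRuleSystem S) {Γ : Finset F} {φ : F}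
    (h : (Γ, {φ}) ∈ S) : (Γ, {ModalLanguage.box φ}) ∈ S :=
  hS.trans (hS.necessitation φ) (by simp [h])
    (by simpa using hS.assumption (φ := ModalLanguage.box φ) (by simp) (by simp))

/-- Replacing the formulae of a rule by interderivable ones. -/
theorem IsRuleSystem.image_mem (hS : IsRuleSystem S) {G : Type} {f g : G → F} {Γ Δ : Finset G}
    (h : (Γ.image f, Δ.image f) ∈ S) (hΓ : ∀ γ ∈ Γ, ({g γ}, {f γ}) ∈ S)
    (hΔ : ∀ δ ∈ Δ, ({f δ}, {g δ}) ∈ S) : (Γ.image g, Δ.image g) ∈ S := by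
  refine hS.trans h ?_ ?_
  · simp only [Finset.mem_image, forall_exists_index, and_imp, forall_apply_eq_imp_iff₂]
    exact fun γ hγ => hS.weaken (hΓ γ hγ)
      (by simpa using ⟨γ, hγ, rfl⟩) subset_rfl
  · simp only [Finset.mem_image, forall_exists_index, and_imp, forall_apply_eq_imp_iff₂]
    exact fun δ hδ => hS.weaken (hΔ δ hδ) (by simp)
      (by simpa using ⟨δ, hδ, rfl⟩)

end RuleSystems

/-! ### Kripke semantics and global consequence over `K4` -/

section Kripke

variable {W : Type} {R : W → W → Prop} {V : ℕ → Set W} {w : W}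

theorem sat_imp {φ ψ : ClmFrm} : Sat R V w (φ.imp ψ) ↔ (Sat R V w φ → Sat R V w ψ) := by
  simp [ClmFrm.imp, Sat]

theorem sat_or {φ ψ : ClmFrm} : Sat R V w (φ.or ψ) ↔ (Sat R V w φ ∨ Sat R V w ψ) := by
  simp only [ClmFrm.or, Sat]; tauto

theorem sat_boxPlus {φ : ClmFrm} :
    Sat R V w φ.boxPlus ↔ ∀ v, Relation.ReflGen R w v → Sat R V v φ := by
  simp only [ClmFrm.boxPlus, Sat, Relation.reflGen_iff]
  grind

theorem sat_subst {s : ℕ → ClmFrm} {φ : ClmFrm} :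
    Sat R V w (φ.subst s) ↔ Sat R (fun n => {v | Sat R V v (s n)}) w φ := by
  induction φ generalizing w <;> simp_all [ClmFrm.subst, Sat]

theorem sat_generated {φ : ClmFrm} {r : W} (hR : ∀ x y z, R x y → R y z → R x z)
    (v : {v // Relation.ReflGen R r v}) :
    Sat (fun a b : {v // Relation.ReflGen R r v} => R a b) (fun n => {v | v.1 ∈ V n}) v φ ↔
      Sat R V v φ := by
  induction φ generalizing v with
  | box φ ih =>
    simp only [Sat]
    refine ⟨fun h u hu => ?_, fun h u hu => (ih u).2 (h u hu)⟩
    refine (ih ⟨u, ?_⟩).1 (h ⟨u, ?_⟩ hu)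
    all_goals
    · obtain ⟨v, hv⟩ := v
      rcases (Relation.reflGen_iff R r v).1 hv with rfl | hv
      · exact .single hu
      · exact .single (hR _ _ _ hv hu)
  | _ => simp_all [Sat]

/-- Consequence over transitive models: global truth of `Φ` entails global truth of `ψ`. -/
def GlobalConseq (Φ : Finset ClmFrm) (ψ : ClmFrm) : Prop :=
  ∀ (W : Type) (R : W → W → Prop), (∀ x y z, R x y → R y z → R x z) → ∀ V : ℕ → Set W,
    (∀ φ ∈ Φ, ∀ w, Sat R V w φ) → ∀ w, Sat R V w ψ

theorem mem_of_transValid {M : RuleSystem ClmFrm} (hM : K4 ≤ M) {φ : ClmFrm}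
    (h : TransValid φ) : axiomRule φ ∈ M.1 :=
  hM (subset_generate _ ⟨φ, h, rfl⟩)

/-- Deduction theorem: necessitation upgrades each premise `φ` to `□⁺φ`, and premises in this form
can be moved into the conclusion as antecedents, leaving a formula valid in transitive frames. -/
theorem mem_of_local {M : RuleSystem ClmFrm} (hM : K4 ≤ M) {Φ : Finset ClmFrm} {ψ : ClmFrm}
    (h : ∀ (W : Type) (R : W → W → Prop), (∀ x y z, R x y → R y z → R x z) →
      ∀ (V : ℕ → Set W) (w : W), (∀ φ ∈ Φ, Sat R V w φ.boxPlus) → Sat R V w ψ) :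
    (Φ, {ψ}) ∈ M.1 := by
  induction Φ using Finset.induction_on generalizing ψ with
  | empty =>
    exact mem_of_transValid hM fun W R hR V w => h W R hR V w (by simp)
  | insert φ Φ _ ih =>
    have h₁ : (Φ, {φ.boxPlus.imp ψ}) ∈ M.1 := ih fun W R hR V w hw => by
      rw [sat_imp]
      exact fun hφ => h W R hR V w (by simpa using ⟨hφ, hw⟩)
    have h₂ : (insert φ Φ, {φ}) ∈ M.1 := M.2.assumption (φ := φ) (by simp) (by simp)
    have h₃ : (insert φ Φ, {φ.box}) ∈ M.1 := M.2.nec h₂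
    have h₄ : axiomRule (φ.box.imp (φ.imp φ.boxPlus)) ∈ M.1 :=
      mem_of_transValid hM fun W R hR V w => by
        simp only [sat_imp, ClmFrm.boxPlus, Sat]
        exact fun a b => ⟨a, b⟩
    have h₅ : (insert φ Φ, {φ.boxPlus}) ∈ M.1 :=
      M.2.mp (M.2.mp (M.2.weaken h₄ (by simp) subset_rfl) h₃) h₂
    exact M.2.mp (M.2.weaken h₁ (Finset.subset_insert _ _) subset_rfl) h₅

/-- In the submodel generated by `w`, the truth of `□⁺φ` at `w` is global truth of `φ`. -/
theorem mem_of_globalConseq {M : RuleSystem ClmFrm} (hM : K4 ≤ M) {Φ : Finset ClmFrm}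
    {ψ : ClmFrm} (h : GlobalConseq Φ ψ) : (Φ, {ψ}) ∈ M.1 := by
  refine mem_of_local hM fun W R hR V w hw => ?_
  have key := h {v // Relation.ReflGen R w v} (fun a b => R a b) (fun x y z => hR x y z)
    (fun n => {v | v.1 ∈ V n})
    (fun φ hφ v => (sat_generated hR v).2 (sat_boxPlus.1 (hw φ hφ) v v.2))
  exact (sat_generated hR _).1 (key ⟨w, .refl⟩)

end Kripke


/-! ### Prime theories of an extension of `mHC` -/

/-- The formulae `φ` such that `/φ` belongs to `L`. -/
def thms (L : RuleSystem SimFrm) : Set SimFrm := {φ | axiomRule φ ∈ L.1}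

/-- A set of formulae that contains the theorems of `L` and is closed under modus ponens. -/
structure IsTheory (L : RuleSystem SimFrm) (x : Set SimFrm) : Prop where
  thms_subset : thms L ⊆ x
  mp : ∀ {φ ψ}, SimFrm.imp φ ψ ∈ x → φ ∈ x → ψ ∈ x

/-- Only the theorems of `L` constrain these sets; the rules of `L` play no part until `canonRules`.
-/
structure IsPrimeTheory (L : RuleSystem SimFrm) (x : Set SimFrm) : Prop
    extends IsTheory L x where
  bot_notMem : SimFrm.bot ∉ x
  prime : ∀ {φ ψ}, SimFrm.or φ ψ ∈ x → φ ∈ x ∨ ψ ∈ x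

section Theories

variable {L : RuleSystem SimFrm} {x : Set SimFrm} {φ ψ χ : SimFrm}

theorem ipc_mem_thms (hL : mHC ≤ L) (h : IPC φ) : φ ∈ thms L :=
  hL (subset_generate _ (.inl ⟨φ, h, rfl⟩))

theorem subst_mem_thms (s : ℕ → SimFrm) (h : φ ∈ thms L) : φ.subst s ∈ thms L := by
  simpa [axiomRule] using! L.2.structurality s _ _ h

theorem box_imp_mem_thms (hL : mHC ≤ L) :
    SimFrm.imp (.box (.imp φ ψ)) (.imp (.box φ) (.box ψ)) ∈ thms L :=
  subst_mem_thms (fun n => if n = 0 then φ else ψ)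
    (hL (subset_generate _ (.inr (.inl rfl))))

theorem imp_box_mem_thms (hL : mHC ≤ L) : SimFrm.imp φ (.box φ) ∈ thms L :=
  subst_mem_thms (fun _ => φ)
    (hL (subset_generate _ (.inr (.inr (.inl rfl)))))

theorem box_imp_or_mem_thms (hL : mHC ≤ L) :
    SimFrm.imp (.box φ) (.or ψ (.imp ψ φ)) ∈ thms L :=
  subst_mem_thms (fun n => if n = 0 then φ else ψ)
    (hL (subset_generate _ (.inr (.inr (.inr rfl)))))

theorem isTheory_thms : IsTheory L (thms L) := ⟨subset_rfl, fun h h' => L.2.mp h h'⟩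

theorem IsTheory.ipc (hx : IsTheory L x) (hL : mHC ≤ L) (h : IPC φ) : φ ∈ x :=
  hx.thms_subset (ipc_mem_thms hL h)

theorem IsTheory.imp_self (hx : IsTheory L x) (hL : mHC ≤ L) : SimFrm.imp φ φ ∈ x :=
  hx.mp (hx.mp (hx.ipc hL (.s φ (.imp φ φ) φ)) (hx.ipc hL (.k _ _))) (hx.ipc hL (.k _ _))

theorem IsTheory.imp_of_mem (hx : IsTheory L x) (hL : mHC ≤ L) (h : φ ∈ x) :
    SimFrm.imp ψ φ ∈ x :=
  hx.mp (hx.ipc hL (.k _ _)) h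

/-- The theory generated by a theory and one formula. -/
theorem IsTheory.adjoin (hx : IsTheory L x) (hL : mHC ≤ L) (φ : SimFrm) :
    IsTheory L {ψ | SimFrm.imp φ ψ ∈ x} where
  thms_subset _ h := hx.imp_of_mem hL (hx.thms_subset h)
  mp h h' := hx.mp (hx.mp (hx.ipc hL (.s _ _ _)) h) h'

theorem IsTheory.and_mem (hx : IsTheory L x) (hL : mHC ≤ L) :
    SimFrm.and φ ψ ∈ x ↔ φ ∈ x ∧ ψ ∈ x :=
  ⟨fun h => ⟨hx.mp (hx.ipc hL (.andLeft _ _)) h, hx.mp (hx.ipc hL (.andRight _ _)) h⟩,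
    fun h => hx.mp (hx.mp (hx.ipc hL (.andIntro _ _)) h.1) h.2⟩

theorem IsPrimeTheory.or_mem (hx : IsPrimeTheory L x) (hL : mHC ≤ L) :
    SimFrm.or φ ψ ∈ x ↔ φ ∈ x ∨ ψ ∈ x :=
  ⟨hx.prime, fun h => h.elim (hx.mp (hx.ipc hL (.orLeft _ _)))
    (hx.mp (hx.ipc hL (.orRight _ _)))⟩

theorem IsTheory.unbox (hx : IsTheory L x) (hL : mHC ≤ L) :
    IsTheory L {φ | SimFrm.box φ ∈ x} where
  thms_subset _ h := hx.mp (hx.thms_subset (imp_box_mem_thms hL)) (hx.thms_subset h)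
  mp h h' := hx.mp (hx.mp (hx.thms_subset (box_imp_mem_thms hL)) h) h'

theorem IsTheory.sUnion {c : Set (Set SimFrm)} (hc : IsChain (· ⊆ ·) c) (hne : c.Nonempty)
    (h : ∀ x ∈ c, IsTheory L x) : IsTheory L (⋃₀ c) where
  thms_subset := by
    obtain ⟨y, hy⟩ := hne
    exact (h y hy).thms_subset.trans (Set.subset_sUnion_of_mem hy)
  mp := by
    rintro φ ψ ⟨y, hy, hφψ⟩ ⟨z, hz, hφ⟩
    obtain ⟨u, hu, hyu, hzu⟩ := hc.directedOn y hy z hz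
    exact ⟨u, hu, (h u hu).mp (hyu hφψ) (hzu hφ)⟩

/-- A theory maximal among those omitting `φ` contains `ψ → φ` for every `ψ` outside it, so
disjunction elimination gives primeness. -/
theorem exists_isPrimeTheory (hL : mHC ≤ L) (hx : IsTheory L x) (hφ : φ ∉ x) :
    ∃ y, IsPrimeTheory L y ∧ x ⊆ y ∧ φ ∉ y := by
  obtain ⟨m, hxm, ⟨hm, hφm⟩, hmax⟩ :=
    zorn_subset_nonempty {y | IsTheory L y ∧ φ ∉ y} (fun c hcs hc hne =>
      ⟨⋃₀ c, ⟨.sUnion hc hne fun y hy => (hcs hy).1, by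
        rintro ⟨y, hy, h⟩; exact (hcs hy).2 h⟩, fun y hy => Set.subset_sUnion_of_mem hy⟩)
      x ⟨hx, hφ⟩
  have key : ∀ ψ, ψ ∉ m → SimFrm.imp ψ φ ∈ m := fun ψ hψ => by
    by_contra h
    exact hψ (hmax ⟨hm.adjoin hL ψ, h⟩ (fun χ hχ => hm.imp_of_mem hL hχ) (hm.imp_self hL))
  refine ⟨m, ⟨hm, fun h => hφm (hm.mp (hm.ipc hL (.botElim _)) h), fun {ψ χ} h => ?_⟩, hxm, hφm⟩
  by_contra! hn
  exact hφm (hm.mp (hm.mp (hm.mp (hm.ipc hL (.orElim _ _ _)) (key _ hn.1)) (key _ hn.2)) h)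

end Theories

/-! ### The canonical frame -/

/-- The points of the canonical frame of `L`, ordered by inclusion. -/
abbrev Canon (L : RuleSystem SimFrm) : Type := {x : Set SimFrm // IsPrimeTheory L x}

def Canon.rel {L : RuleSystem SimFrm} (x y : Canon L) : Prop :=
  ∀ φ, SimFrm.box φ ∈ x.1 → φ ∈ y.1

/-- The set of prime theories containing `φ`. -/
def Canon.extent (L : RuleSystem SimFrm) (φ : SimFrm) : Set (Canon L) := {x | φ ∈ x.1}

/-- The Boolean algebra of sets of prime theories generated by the extents. -/
def Canon.algebra (L : RuleSystem SimFrm) : BooleanSubalgebra (Set (Canon L)) :=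
  BooleanSubalgebra.closure (Set.range (Canon.extent L))

section Canon

open Canon

variable {L : RuleSystem SimFrm} {φ ψ : SimFrm} {x y z : Canon L}

theorem Canon.rel_le (hL : mHC ≤ L) (h : rel x y) : x ≤ y := fun _ hφ =>
  h _ (x.2.mp (x.2.thms_subset (imp_box_mem_thms hL)) hφ)

theorem Canon.rel_trans (hL : mHC ≤ L) (h : rel x y) (h' : rel y z) : rel x z :=
  fun φ hφ => rel_le hL h' (h φ hφ)

theorem Canon.rel_of_rel_of_le (h : rel x y) (h' : y ≤ z) : rel x z :=
  fun φ hφ => h' (h φ hφ)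

/-- This is where `⊠p → (q ∨ (q → p))` is used: take for `q` a formula in `y` but not in `x`. -/
theorem Canon.rel_of_lt (hL : mHC ≤ L) (h : x < y) : rel x y := by
  obtain ⟨hle, hne⟩ := h
  obtain ⟨ψ, hψy, hψx⟩ := Set.not_subset.1 hne
  intro φ hφ
  have h₁ := x.2.prime (x.2.mp (x.2.thms_subset (box_imp_or_mem_thms (ψ := ψ) hL)) hφ)
  exact y.2.mp (hle (h₁.resolve_left hψx)) hψy

theorem Canon.reflGen_rel (hL : mHC ≤ L) : Relation.ReflGen rel x y ↔ x ≤ y := by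
  rw [Relation.reflGen_iff]
  constructor
  · rintro (rfl | h)
    exacts [le_rfl, rel_le hL h]
  · intro h
    rcases h.eq_or_lt with rfl | h
    exacts [.inl rfl, .inr (rel_of_lt hL h)]

theorem Canon.mem_thms (hL : mHC ≤ L) (h : ∀ x : Canon L, φ ∈ x.1) : φ ∈ thms L := by
  by_contra hφ
  obtain ⟨y, hy, -, hφy⟩ := exists_isPrimeTheory hL isTheory_thms hφ
  exact hφy (h ⟨y, hy⟩)

/-- Stated for an arbitrary theory so as to apply to a point, to its unboxing (giving boxed
implications) and to the theorems of `L`. -/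
theorem Canon.imp_mem_of (hL : mHC ≤ L) {F : Set SimFrm} (hF : IsTheory L F)
    (h : ∀ y : Canon L, F ⊆ y.1 → φ ∈ y.1 → ψ ∈ y.1) : SimFrm.imp φ ψ ∈ F := by
  by_contra hn
  obtain ⟨y, hy, hxy, hψ⟩ := exists_isPrimeTheory hL (hF.adjoin hL φ) hn
  exact hψ (h ⟨y, hy⟩ (fun χ hχ => hxy (hF.imp_of_mem hL hχ)) (hxy (hF.imp_self hL)))

theorem Canon.imp_mem (hL : mHC ≤ L) :
    SimFrm.imp φ ψ ∈ x.1 ↔ ∀ y, x ≤ y → φ ∈ y.1 → ψ ∈ y.1 :=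
  ⟨fun h y hxy hφ => y.2.mp (hxy h) hφ, fun h => imp_mem_of hL x.2.toIsTheory fun y => h y⟩

theorem Canon.box_imp_mem (hL : mHC ≤ L) :
    SimFrm.box (.imp φ ψ) ∈ x.1 ↔ ∀ y, rel x y → φ ∈ y.1 → ψ ∈ y.1 :=
  ⟨fun h y hxy hφ => y.2.mp (hxy _ h) hφ,
    fun h => imp_mem_of hL (x.2.unbox hL) fun y hxy => h y fun _ hφ => hxy hφ⟩

theorem Canon.box_mem (hL : mHC ≤ L) : SimFrm.box φ ∈ x.1 ↔ ∀ y, rel x y → φ ∈ y.1 := by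
  refine ⟨fun h y hxy => hxy _ h, fun h => ?_⟩
  by_contra hn
  obtain ⟨y, hy, hxy, hφ⟩ := exists_isPrimeTheory hL (x.2.unbox hL) hn
  exact hφ (h ⟨y, hy⟩ fun φ hφ => hxy hφ)

theorem Canon.extent_mem_algebra (φ : SimFrm) : extent L φ ∈ algebra L :=
  BooleanSubalgebra.subset_closure ⟨φ, rfl⟩

theorem Canon.isSublattice_range_extent (hL : mHC ≤ L) :
    IsSublattice (Set.range (extent L)) where
  supClosed := by
    rintro _ ⟨φ, rfl⟩ _ ⟨ψ, rfl⟩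
    exact ⟨.or φ ψ, Set.ext fun x => x.2.or_mem hL⟩
  infClosed := by
    rintro _ ⟨φ, rfl⟩ _ ⟨ψ, rfl⟩
    exact ⟨.and φ ψ, Set.ext fun x => x.2.toIsTheory.and_mem hL⟩

/-- Every element of the algebra has a largest extent below it, which also computes its box. -/
theorem Canon.exists_interior (hL : mHC ≤ L) {U : Set (Canon L)} (hU : U ∈ algebra L) :
    ∃ φ : SimFrm, ∀ x : Canon L, (φ ∈ x.1 ↔ ∀ y, x ≤ y → y ∈ U) ∧
      (SimFrm.box φ ∈ x.1 ↔ ∀ y, rel x y → y ∈ U) := by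
  suffices H : ∀ U ∈ algebra L, ∃ φ : SimFrm, ∀ x : Canon L,
      (φ ∈ x.1 ↔ ∀ y, x ≤ y → y ∉ U) ∧ (SimFrm.box φ ∈ x.1 ↔ ∀ y, rel x y → y ∉ U) by
    simpa using H Uᶜ (BooleanSubalgebra.compl_mem hU)
  intro U hU
  have hbot : (⊥ : Set (Canon L)) ∈ Set.range (extent L) :=
    ⟨.bot, Set.eq_empty_of_forall_notMem fun x => x.2.bot_notMem⟩
  have htop : (⊤ : Set (Canon L)) ∈ Set.range (extent L) :=
    ⟨.top, Set.eq_univ_of_forall fun x => x.2.ipc hL .topIntro⟩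
  -- Members of the algebra are finite unions of differences of extents. The complement of such a
  -- difference has an implication as its interior, and interiors commute with intersections.
  refine BooleanSubalgebra.closure_sdiff_sup_induction (isSublattice_range_extent hL) hbot htop
    (p := fun U _ => ∃ φ : SimFrm, ∀ x : Canon L,
      (φ ∈ x.1 ↔ ∀ y, x ≤ y → y ∉ U) ∧ (SimFrm.box φ ∈ x.1 ↔ ∀ y, rel x y → y ∉ U))
    ?_ ?_ U hU
  · rintro _ ⟨φ, rfl⟩ _ ⟨ψ, rfl⟩
    refine ⟨.imp φ ψ, fun x => ?_⟩
    simp [imp_mem hL, box_imp_mem hL, extent]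
  · rintro U - V - ⟨φ, hφ⟩ ⟨ψ, hψ⟩
    refine ⟨.and φ ψ, fun x => ⟨?_, ?_⟩⟩
    · rw [x.2.toIsTheory.and_mem hL, (hφ x).1, (hψ x).1]
      simp only [Set.sup_eq_union, Set.mem_union, not_or]
      grind
    · rw [box_mem hL]
      simp only [fun y : Canon L => y.2.toIsTheory.and_mem hL (φ := φ) (ψ := ψ),
        Set.sup_eq_union, Set.mem_union, not_or, forall_and]
      rw [← box_mem hL, ← box_mem hL, (hφ x).2, (hψ x).2]

open Classical in
/-- A formula whose extent is the interior of `U`. -/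
noncomputable def Canon.interior (U : Set (Canon L)) : SimFrm :=
  if h : ∃ φ : SimFrm, ∀ x : Canon L, φ ∈ x.1 ↔ ∀ y, x ≤ y → y ∈ U then h.choose else .bot

theorem Canon.interior_mem (hL : mHC ≤ L) {U : Set (Canon L)} (hU : U ∈ algebra L) :
    interior U ∈ x.1 ↔ ∀ y, x ≤ y → y ∈ U := by
  have h : ∃ φ : SimFrm, ∀ x : Canon L, φ ∈ x.1 ↔ ∀ y, x ≤ y → y ∈ U :=
    (exists_interior hL hU).imp fun φ hφ x => (hφ x).1
  rw [interior, dif_pos h]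
  exact h.choose_spec x

theorem Canon.setOf_sat_mem_algebra (hL : mHC ≤ L) {V : ℕ → Set (Canon L)}
    (hV : ∀ n, V n ∈ algebra L) (φ : ClmFrm) : {x | Sat rel V x φ} ∈ algebra L := by
  induction φ with
  | var n => exact hV n
  | bot => exact (algebra L).bot_mem
  | top => exact (algebra L).top_mem
  | and φ ψ ihφ ihψ => exact (algebra L).infClosed ihφ ihψ
  | neg φ ih => exact BooleanSubalgebra.compl_mem ih
  | box φ ih =>
    obtain ⟨χ, hχ⟩ := exists_interior hL ih
    convert extent_mem_algebra (L := L) (.box χ) using 1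
    exact Set.ext fun x => (hχ x).2.symm

theorem Canon.sat_T (hL : mHC ≤ L) {V : ℕ → Set (Canon L)} (hV : ∀ n, V n ∈ algebra L)
    (φ : SimFrm) : Sat rel V x (T φ) ↔ φ.subst (fun n => interior (V n)) ∈ x.1 := by
  induction φ generalizing x with
  | var n => simp only [T, sat_boxPlus, reflGen_rel hL, SimFrm.subst, interior_mem hL (hV n), Sat]
  | bot => simpa [T, Sat, SimFrm.subst] using x.2.bot_notMem
  | top => simpa [T, Sat, SimFrm.subst] using x.2.ipc hL .topIntro
  | and φ ψ ihφ ihψ => simp only [T, Sat, SimFrm.subst, x.2.toIsTheory.and_mem hL, ihφ, ihψ]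
  | or φ ψ ihφ ihψ => simp only [T, sat_or, SimFrm.subst, x.2.or_mem hL, ihφ, ihψ]
  | imp φ ψ ihφ ihψ =>
    simp only [T, sat_boxPlus, sat_or, Sat, reflGen_rel hL, SimFrm.subst, imp_mem hL, ihφ, ihψ,
      imp_iff_not_or]
  | box φ ih => simp only [T, Sat, SimFrm.subst, box_mem hL, ih]

/-- Membership of the union of a chain of prime theories in an element of the algebra is
eventually constant along the chain. -/
theorem Canon.eventually_mem_iff {c : Set (Canon L)} (hc : IsChain (· ≤ ·) c) (hne : c.Nonempty)
    {m : Canon L} (hm : ∀ φ, φ ∈ m.1 ↔ ∃ x ∈ c, φ ∈ x.1) {U : Set (Canon L)}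
    (hU : U ∈ algebra L) : ∃ x ∈ c, ∀ y ∈ c, x ≤ y → (y ∈ U ↔ m ∈ U) := by
  refine BooleanSubalgebra.closure_bot_sup_induction
    (p := fun U _ => ∃ x ∈ c, ∀ y ∈ c, x ≤ y → (y ∈ U ↔ m ∈ U)) ?_ ?_ ?_ ?_ hU
  · rintro _ ⟨φ, rfl⟩
    by_cases h : φ ∈ m.1
    · obtain ⟨x, hx, hφ⟩ := (hm φ).1 h
      exact ⟨x, hx, fun y _ hxy => iff_of_true (hxy hφ) h⟩
    · obtain ⟨x, hx⟩ := hne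
      exact ⟨x, hx, fun y hy _ => iff_of_false (fun hφ => h ((hm φ).2 ⟨y, hy, hφ⟩)) h⟩
  · obtain ⟨x, hx⟩ := hne
    exact ⟨x, hx, fun y _ _ => Iff.rfl⟩
  · rintro U - V - ⟨x, hx, hU⟩ ⟨y, hy, hV⟩
    obtain ⟨z, hz, hxz, hyz⟩ := hc.directedOn x hx y hy
    exact ⟨z, hz, fun u hu hzu => or_congr (hU u hu (hxz.trans hzu)) (hV u hu (hyz.trans hzu))⟩
  · rintro U - ⟨x, hx, hU⟩
    exact ⟨x, hx, fun y hy hxy => not_congr (hU y hy hxy)⟩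

/-- The union of a chain of prime theories is a prime theory, and it stays in `U` because membership
in `U` stabilises along the chain. -/
theorem Canon.exists_maximal {U : Set (Canon L)} (hU : U ∈ algebra L) (hx : x ∈ U) :
    ∃ m, x ≤ m ∧ Maximal (· ∈ U) m := by
  refine zorn_le_nonempty₀ U (fun c hcU hc y hy => ?_) x hx
  have hne : c.Nonempty := ⟨y, hy⟩
  have hc' : IsChain (· ⊆ ·) (Subtype.val '' c) := by
    rintro _ ⟨a, ha, rfl⟩ _ ⟨b, hb, rfl⟩ -
    exact hc.total ha hb
  have hT : IsTheory L (⋃₀ (Subtype.val '' c)) :=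
    .sUnion hc' (hne.image _) (by rintro _ ⟨x, -, rfl⟩; exact x.2.toIsTheory)
  let m : Canon L := ⟨⋃₀ (Subtype.val '' c), { hT with
    bot_notMem := by rintro ⟨_, ⟨x, -, rfl⟩, h⟩; exact x.2.bot_notMem h
    prime := by
      rintro φ ψ ⟨_, ⟨x, hx, rfl⟩, h⟩
      exact (x.2.prime h).imp (fun h => ⟨_, ⟨x, hx, rfl⟩, h⟩) (fun h => ⟨_, ⟨x, hx, rfl⟩, h⟩) }⟩
  have hm : ∀ φ, φ ∈ m.1 ↔ ∃ x ∈ c, φ ∈ x.1 := by simp [m]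
  obtain ⟨z, hz, h⟩ := eventually_mem_iff hc hne hm hU
  exact ⟨m, (h z hz le_rfl).1 (hcU hz), fun u hu φ hφ => (hm φ).2 ⟨u, hu, hφ⟩⟩

theorem Canon.sat_grz (hL : mHC ≤ L) {V : ℕ → Set (Canon L)} (hV : V 0 ∈ algebra L) :
    Sat rel V x grzAxiom := by
  simp only [grzAxiom, sat_imp, Sat]
  intro h y hxy
  by_contra hy
  -- At a maximal point `z` refuting `p`, a successor satisfying `p` differs from `z`, so nothing it
  -- sees can refute `p`. Hence `□(p → □p)` holds at `z`, and the premise forces `p` there.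
  obtain ⟨z, hyz, hz, hmax⟩ := exists_maximal (BooleanSubalgebra.compl_mem hV) hy
  refine hz (h z (rel_of_rel_of_le hxy hyz) fun w hzw hw v hwv => ?_)
  by_contra hv
  have hvz := hmax hv ((rel_le hL hzw).trans (rel_le hL hwv))
  exact hz (le_antisymm (rel_le hL hzw) ((rel_le hL hwv).trans hvz) ▸ hw)

/-! ### The rules valid in the canonical algebra, relative to `L` -/

/-- The formula expressing global truth of `φ` under the valuation `V`. -/
noncomputable def Canon.value (V : ℕ → Set (Canon L)) (φ : ClmFrm) : SimFrm :=
  interior {x | Sat rel V x φ}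

theorem Canon.value_mem (hL : mHC ≤ L) {V : ℕ → Set (Canon L)} (hV : ∀ n, V n ∈ algebra L)
    {φ : ClmFrm} : value V φ ∈ x.1 ↔ ∀ y, x ≤ y → Sat rel V y φ :=
  interior_mem hL (setOf_sat_mem_algebra hL hV φ)

theorem rule_of_le (hL : mHC ≤ L) (h : ∀ x : Canon L, φ ∈ x.1 → ψ ∈ x.1) :
    ({φ}, {ψ}) ∈ L.1 := by
  have h₁ : SimFrm.imp φ ψ ∈ thms L := imp_mem_of hL isTheory_thms fun y _ => h y
  exact L.2.mp (L.2.weaken h₁ (by simp) subset_rfl)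
    (L.2.reflexivity φ)

/-- The `clm`-rules whose value under every admissible valuation belongs to `L`. -/
noncomputable def canonRules (hL : mHC ≤ L) : RuleSystem ClmFrm :=
  ⟨{r | ∀ V : ℕ → Set (Canon L), (∀ n, V n ∈ algebra L) →
      (r.1.image (value V), r.2.image (value V)) ∈ L.1},
    { structurality := fun s Γ Δ h V hV => by
        have := h (fun n => {x | Sat rel V x (s n)}) fun n => setOf_sat_mem_algebra hL hV (s n)
        have key : value V ∘ ModalLanguage.subst s = value fun n => {x | Sat rel V x (s n)} := by
          ext φ
          simp only [Function.comp_apply, value]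
          exact congrArg interior (Set.ext fun x => sat_subst)
        change (Finset.image _ (Finset.image _ _), Finset.image _ (Finset.image _ _)) ∈ L.1
        rw [Finset.image_image, Finset.image_image, key]
        exact this
      reflexivity := fun φ V _ => by simpa using L.2.reflexivity _
      monotonicity := fun Γ Δ Γ' Δ' h V hV => by
        simpa only [Finset.image_union] using L.2.monotonicity _ _ _ _ (h V hV)
      cut := fun Γ Δ φ h₁ h₂ V hV => by
        have h₁ := h₁ V hV
        have h₂ := h₂ V hV
        simp only [Finset.image_insert] at h₁ h₂
        exact L.2.cut _ _ _ h₁ h₂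
      modusPonens := fun φ ψ V hV => by
        simp only [Finset.image_insert, Finset.image_singleton]
        have h : ({value V (φ.imp ψ)}, {.imp (value V φ) (value V ψ)}) ∈ L.1 :=
          rule_of_le hL fun x hx => (imp_mem hL).2 fun y hxy hy => by
            rw [value_mem hL hV] at hx hy ⊢
            exact fun z hyz => sat_imp.1 (hx z (hxy.trans hyz)) (hy z hyz)
        exact L.2.mp (φ := value V φ) (L.2.weaken h (by simp [ModalLanguage.imp]) subset_rfl)
          (L.2.assumption (φ := value V φ) (by simp) (by simp))
      necessitation := fun φ V hV => by
        simp only [Finset.image_singleton]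
        refine rule_of_le hL fun x hx => ?_
        rw [value_mem hL hV] at hx ⊢
        exact fun y hxy z hyz => hx z (hxy.trans (rel_le hL hyz)) }⟩

theorem axiomRule_mem_canonRules (hL : mHC ≤ L) {φ : ClmFrm}
    (h : ∀ V : ℕ → Set (Canon L), (∀ n, V n ∈ algebra L) → ∀ x, Sat rel V x φ) :
    axiomRule φ ∈ (canonRules hL).1 := fun V hV => by
  simpa [axiomRule] using! Canon.mem_thms hL fun x => (value_mem hL hV).2 fun y _ => h V hV y

theorem K4_le_canonRules (hL : mHC ≤ L) : K4 ≤ canonRules hL := by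
  refine generate_le ?_
  rintro _ ⟨φ, hφ, rfl⟩
  exact axiomRule_mem_canonRules hL fun V _ x =>
    hφ _ rel (fun _ _ _ => rel_trans hL) V x

theorem value_T_mem (hL : mHC ≤ L) {V : ℕ → Set (Canon L)} (hV : ∀ n, V n ∈ algebra L) :
    value V (T φ) ∈ x.1 ↔ φ.subst (fun n => interior (V n)) ∈ x.1 := by
  simp only [value_mem hL hV, sat_T hL hV]
  exact ⟨fun h => h x le_rfl, fun h y hxy => hxy h⟩

/-- For a translated rule of `L`, the value of each formula is interderivable with a substitution
instance of the original, so structurality of `L` applies. -/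
theorem sigma_le_canonRules (hL : mHC ≤ L) : sigma L ≤ canonRules hL := by
  refine generate_le (Set.union_subset (generate_le (Set.union_subset (K4_le_canonRules hL) ?_))
    (generate_le (Set.union_subset (K4_le_canonRules hL) ?_)))
  · rintro _ rfl
    exact axiomRule_mem_canonRules hL fun V hV x => sat_grz hL (hV 0)
  · rintro _ ⟨⟨Γ, Δ⟩, h, rfl⟩ V hV
    simp only [TRule, Finset.image_image]
    exact L.2.image_mem (L.2.structurality (fun n => interior (V n)) _ _ h)
      (fun φ _ => rule_of_le hL fun x => (value_T_mem hL hV).1)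
      (fun φ _ => rule_of_le hL fun x => (value_T_mem hL hV).2)

theorem rho_sigma_subset (hL : mHC ≤ L) : rho (sigma L) ⊆ L.1 := by
  rintro ⟨Γ, Δ⟩ h
  have hV : ∀ n, extent L (.var n) ∈ algebra L := fun n => extent_mem_algebra _
  -- Under this valuation the value of `T φ` belongs to the same prime theories as `φ`, so the rule
  -- obtained is interderivable with the original.
  have := sigma_le_canonRules hL h (fun n => extent L (.var n)) hV
  simp only [TRule, Finset.image_image] at this
  have key : ∀ (φ : SimFrm) (x : Canon L),
      value (fun n => extent L (.var n)) (T φ) ∈ x.1 ↔ φ ∈ x.1 := fun φ x => by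
    rw [value_T_mem hL hV]
    induction φ generalizing x with
    | var n =>
      simp only [SimFrm.subst, interior_mem hL (hV n)]
      exact ⟨fun h => h x le_rfl, fun h y hxy => hxy h⟩
    | bot => rfl
    | top => rfl
    | and φ ψ ihφ ihψ => simp only [SimFrm.subst, x.2.toIsTheory.and_mem hL, ihφ, ihψ]
    | or φ ψ ihφ ihψ => simp only [SimFrm.subst, x.2.or_mem hL, ihφ, ihψ]
    | imp φ ψ ihφ ihψ => simp only [SimFrm.subst, imp_mem hL, ihφ, ihψ]
    | box φ ih => simp only [SimFrm.subst, box_mem hL, ih]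
  simpa using L.2.image_mem (g := id) this (fun φ _ => rule_of_le hL fun x => (key φ x).2)
    (fun φ _ => rule_of_le hL fun x => (key φ x).1)

end Canon


/-! ### Boolean combinations of translated formulae -/

theorem rel_of_reflGen_right {W : Type} {R : W → W → Prop}
    (hR : ∀ x y z, R x y → R y z → R x z) {x y z : W}
    (h : R x y) (h' : Relation.ReflGen R y z) : R x z := by
  rcases (Relation.reflGen_iff R y z).1 h' with rfl | h'
  exacts [h, hR _ _ _ h h']

/-- A pointed transitive Kripke model. -/
structure PointedModel : Type 1 where
  carrier : Type
  rel : carrier → carrier → Prop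
  trans : ∀ x y z, rel x y → rel y z → rel x z
  val : ℕ → Set carrier
  point : carrier

namespace PointedModel

def sat (m : PointedModel) (φ : ClmFrm) : Prop := Sat m.rel m.val m.point φ

/-- The same model with another distinguished point. -/
def move (m : PointedModel) (v : m.carrier) : PointedModel := { m with point := v }

def models (φ : ClmFrm) : Set PointedModel := {m | m.sat φ}

/-- Boolean combinations of translated formulae, up to equivalence over transitive models. -/
def combs : BooleanSubalgebra (Set PointedModel) :=
  BooleanSubalgebra.closure (Set.range fun φ : SimFrm => models (T φ))

theorem isSublattice_range_models_T :
    IsSublattice (Set.range fun φ : SimFrm => models (T φ)) where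
  supClosed := by
    rintro _ ⟨φ, rfl⟩ _ ⟨ψ, rfl⟩
    exact ⟨.or φ ψ, Set.ext fun m => sat_or⟩
  infClosed := by
    rintro _ ⟨φ, rfl⟩ _ ⟨ψ, rfl⟩
    exact ⟨.and φ ψ, rfl⟩

/-- Same normal form as for `Canon.exists_interior`: `□⁺` of the complement of a difference is a
translated implication, and `□⁺` commutes with conjunction. -/
theorem exists_T_iff {U : Set PointedModel} (hU : U ∈ combs) :
    ∃ φ : SimFrm, ∀ m : PointedModel,
      m.sat (T φ) ↔ ∀ v, Relation.ReflGen m.rel m.point v → m.move v ∈ U := by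
  suffices H : ∀ U ∈ combs, ∃ φ : SimFrm, ∀ m : PointedModel,
      m.sat (T φ) ↔ ∀ v, Relation.ReflGen m.rel m.point v → m.move v ∉ U by
    simpa using H Uᶜ (BooleanSubalgebra.compl_mem hU)
  intro U hU
  have hbot : (⊥ : Set PointedModel) ∈ Set.range fun φ : SimFrm => models (T φ) := ⟨.bot, rfl⟩
  have htop : (⊤ : Set PointedModel) ∈ Set.range fun φ : SimFrm => models (T φ) := ⟨.top, rfl⟩
  refine BooleanSubalgebra.closure_sdiff_sup_induction isSublattice_range_models_T hbot htop
    (p := fun U _ => ∃ φ : SimFrm, ∀ m : PointedModel,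
      m.sat (T φ) ↔ ∀ v, Relation.ReflGen m.rel m.point v → m.move v ∉ U) ?_ ?_ U hU
  · rintro _ ⟨φ, rfl⟩ _ ⟨ψ, rfl⟩
    refine ⟨.imp φ ψ, fun m => ?_⟩
    simp [T, sat, sat_boxPlus, sat_or, Sat, models, move, imp_iff_not_or]
  · rintro U - V - ⟨φ, hφ⟩ ⟨ψ, hψ⟩
    refine ⟨.and φ ψ, fun m => ?_⟩
    change m.sat (T φ) ∧ m.sat (T ψ) ↔ _
    rw [hφ, hψ]
    simp only [Set.sup_eq_union, Set.mem_union, not_or]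
    grind

theorem models_subst_mem_combs {s : ℕ → ClmFrm} (hs : ∀ n, models (s n) ∈ combs) (φ : ClmFrm) :
    models (φ.subst s) ∈ combs := by
  induction φ with
  | var n => exact hs n
  | bot => exact combs.bot_mem
  | top => exact combs.top_mem
  | and φ ψ ihφ ihψ => exact combs.infClosed ihφ ihψ
  | neg φ ih => exact BooleanSubalgebra.compl_mem ih
  | box φ ih =>
    -- By transitivity `□` and `□□⁺` agree, so the box of a combination is the box of a translated
    -- formula.
    obtain ⟨χ, hχ⟩ := exists_T_iff ih
    refine (congrArg (· ∈ combs) (Set.ext fun m => ?_)).mp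
      (BooleanSubalgebra.subset_closure ⟨.box χ, rfl⟩)
    change (∀ v, m.rel m.point v → (m.move v).sat (T χ)) ↔
      ∀ v, m.rel m.point v → (m.move v).sat (φ.subst s)
    simp only [hχ]
    constructor
    · exact fun h v hv => h v hv v .refl
    · exact fun h v hv u hu => h u (rel_of_reflGen_right m.trans hv hu)

end PointedModel

open PointedModel

/-- Under a substitution by Boolean combinations of translated formulae, every rule becomes the
translation of a `∼`-rule, up to equivalence over `K4`. -/
theorem exists_T_subst {s : ℕ → ClmFrm} (hs : ∀ n, models (s n) ∈ combs) (φ : ClmFrm) :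
    ∃ χ : SimFrm, GlobalConseq {T χ} (φ.subst s) ∧ GlobalConseq {φ.subst s} (T χ) := by
  obtain ⟨χ, hχ⟩ := exists_T_iff (models_subst_mem_combs hs φ)
  refine ⟨χ, fun W R hR V h w => ?_, fun W R hR V h w => ?_⟩
  · exact (hχ ⟨W, R, hR, V, w⟩).1 (h _ (by simp) w) w .refl
  · exact (hχ ⟨W, R, hR, V, w⟩).2 fun v _ => h _ (by simp) v

/-- The substituted rule is interderivable over `K4` with a translated one; the latter lies in `M`,
so its source lies in `ρM = L`, and the translation of that source returns to `τL`. -/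
theorem subst_rule_mem_tau {L : RuleSystem SimFrm} {M : RuleSystem ClmFrm}
    (hM : IsMonomodalCompanion M L) {s : ℕ → ClmFrm} (hs : ∀ n, models (s n) ∈ combs)
    {Γ Δ : Finset ClmFrm} (h : (Γ, Δ) ∈ M.1) :
    (Γ.image (ClmFrm.subst s), Δ.image (ClmFrm.subst s)) ∈ (tau L).1 := by
  choose f hf hf' using exists_T_subst hs
  have hK : K4 ≤ tau L := Set.subset_union_left.trans (subset_generate _)
  have h₁ : (Γ.image (T ∘ f), Δ.image (T ∘ f)) ∈ M.1 :=
    M.2.image_mem (M.2.structurality s _ _ h)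
      (fun φ _ => mem_of_globalConseq hM.1 (hf φ)) (fun φ _ => mem_of_globalConseq hM.1 (hf' φ))
  have h₂ : (Γ.image f, Δ.image f) ∈ L.1 := by
    rw [hM.2]
    simpa only [rho, TRule, Set.mem_ofPred_eq, Finset.image_image] using h₁
  have h₃ : (Γ.image (T ∘ f), Δ.image (T ∘ f)) ∈ (tau L).1 := by
    have := subset_generate (K4.1 ∪ TRule '' L.1) (.inr ⟨_, h₂, rfl⟩)
    simpa only [TRule, Finset.image_image, tau, oplus] using this
  exact (tau L).2.image_mem h₃
    (fun φ _ => mem_of_globalConseq hK (hf' φ)) (fun φ _ => mem_of_globalConseq hK (hf φ))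

/-! ### Functional completeness -/

open Classical in
-- Every truth function `Q` of the `f i` is definable, by case distinction on one index at a time.
theorem exists_sat_iff {ι : Type} (f : ι → ClmFrm) (I : Finset ι) (Q : Finset ι → Prop) :
    ∃ χ : ClmFrm, (∀ B : BooleanSubalgebra (Set PointedModel),
        (∀ i ∈ I, models (f i) ∈ B) → models χ ∈ B) ∧
      ∀ (W : Type) (R : W → W → Prop) (V : ℕ → Set W) (w : W),
        Sat R V w χ ↔ Q {i ∈ I | Sat R V w (f i)} := by
  induction I using Finset.induction_on generalizing Q with
  | empty =>
    by_cases h : Q ∅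
    · exact ⟨.top, fun B _ => B.top_mem, fun W R V w => by simp [Sat, h]⟩
    · exact ⟨.bot, fun B _ => B.bot_mem, fun W R V w => by simp [Sat, h]⟩
  | insert i I hi ih =>
    obtain ⟨χ₁, hB₁, h₁⟩ := ih fun J => Q (insert i J)
    obtain ⟨χ₂, hB₂, h₂⟩ := ih Q
    refine ⟨.and ((f i).imp χ₁) ((f i).neg.imp χ₂), fun B hB => ?_, fun W R V w => ?_⟩
    · have a := hB i (by simp)
      have b := hB₁ B fun j hj => hB j (by simp [hj])
      have c := hB₂ B fun j hj => hB j (by simp [hj])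
      have ac := BooleanSubalgebra.compl_mem a
      refine B.infClosed
        (BooleanSubalgebra.compl_mem (B.infClosed a (BooleanSubalgebra.compl_mem b)))
        (BooleanSubalgebra.compl_mem (B.infClosed ac (BooleanSubalgebra.compl_mem c)))
    · simp only [Sat, sat_imp, Finset.filter_insert]
      split_ifs with h <;> simp [h, h₁, h₂]

/-! ### Removing variables in the presence of the Grzegorczyk axiom -/

def ClmFrm.subformulas : ClmFrm → Finset ClmFrm
  | .var n => {.var n}
  | .bot => {.bot}
  | .top => {.top}
  | .and φ ψ => insert (.and φ ψ) (φ.subformulas ∪ ψ.subformulas)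
  | .neg φ => insert (.neg φ) φ.subformulas
  | .box φ => insert (.box φ) φ.subformulas

theorem ClmFrm.self_mem_subformulas (φ : ClmFrm) : φ ∈ φ.subformulas := by
  cases φ <;> simp [ClmFrm.subformulas]

theorem ClmFrm.subformulas_subset {φ ψ : ClmFrm} (h : φ ∈ ψ.subformulas) :
    φ.subformulas ⊆ ψ.subformulas := by
  induction ψ with
  | var n => simp_all [ClmFrm.subformulas]
  | bot => simp_all [ClmFrm.subformulas]
  | top => simp_all [ClmFrm.subformulas]
  | and ψ χ ih₁ ih₂ =>
    simp only [ClmFrm.subformulas, Finset.mem_insert, Finset.mem_union] at h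
    rcases h with rfl | h | h
    · rfl
    · exact (ih₁ h).trans (by grind [ClmFrm.subformulas])
    · exact (ih₂ h).trans (by grind [ClmFrm.subformulas])
  | neg ψ ih =>
    simp only [ClmFrm.subformulas, Finset.mem_insert] at h
    rcases h with rfl | h
    · rfl
    · exact (ih h).trans (Finset.subset_insert _ _)
  | box ψ ih =>
    simp only [ClmFrm.subformulas, Finset.mem_insert] at h
    rcases h with rfl | h
    · rfl
    · exact (ih h).trans (Finset.subset_insert _ _)

def SubformulaClosed (Θ : Finset ClmFrm) : Prop := ∀ φ ∈ Θ, φ.subformulas ⊆ Θ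

/-! ### Types, final points and recolouring -/

section Types

open Classical in
/-- The members of `Θ` true at `x`. -/
noncomputable def typeAt (Θ : Finset ClmFrm) {W : Type} (R : W → W → Prop) (V : ℕ → Set W)
    (x : W) : Finset ClmFrm := {φ ∈ Θ | Sat R V x φ}

/-- `x` is final if the colour of `x` is not left and entered again above `x`. -/
def IsFinal {W C : Type} (R : W → W → Prop) (t : W → C) (x : W) : Prop :=
  ∀ y, Relation.ReflGen R x y → (∃ z, Relation.ReflGen R y z ∧ t z = t x) → t y = t x

variable {W : Type} {R : W → W → Prop} {V : ℕ → Set W} {Θ : Finset ClmFrm}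

theorem mem_typeAt {x : W} {φ : ClmFrm} : φ ∈ typeAt Θ R V x ↔ φ ∈ Θ ∧ Sat R V x φ := by
  simp [typeAt]

/-- A recolouring by types that keeps the final points and gives every other point a reflexive
type satisfies the truth lemma. -/
theorem sat_recolour (hΘ : SubformulaClosed Θ) (hR : ∀ x y z, R x y → R y z → R x z)
    (hfin : ∀ x, ¬ IsFinal R (typeAt Θ R V) x →
      ∃ y, R x y ∧ typeAt Θ R V y = typeAt Θ R V x ∧ IsFinal R (typeAt Θ R V) y)
    {t : W → Finset ClmFrm}
    (ht : ∀ x, ∃ y, Relation.ReflGen R x y ∧ t x = typeAt Θ R V y)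
    (ht_fin : ∀ x, IsFinal R (typeAt Θ R V) x → t x = typeAt Θ R V x)
    (ht_box : ∀ x, ¬ IsFinal R (typeAt Θ R V) x → ∀ φ, ClmFrm.box φ ∈ Θ →
      (ClmFrm.box φ ∈ t x ↔ ∀ y, Relation.ReflGen R x y → φ ∈ typeAt Θ R V y))
    {V' : ℕ → Set W} (hV' : ∀ n, ClmFrm.var n ∈ Θ → ∀ x, x ∈ V' n ↔ ClmFrm.var n ∈ t x)
    {φ : ClmFrm} (hφ : φ ∈ Θ) (x : W) : Sat R V' x φ ↔ φ ∈ t x := by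
  -- Every type visible from `x` through `R` survives the recolouring, since a final point of that
  -- type keeps it.
  have hsee : ∀ x y, R x y → ∃ z, R x z ∧ t z = typeAt Θ R V y := fun x y hxy => by
    by_cases hy : IsFinal R (typeAt Θ R V) y
    · exact ⟨y, hxy, ht_fin y hy⟩
    · obtain ⟨z, hyz, hz, hzf⟩ := hfin y hy
      exact ⟨z, hR _ _ _ hxy hyz, (ht_fin z hzf).trans hz⟩
  have hall : ∀ x φ, (∀ y, R x y → φ ∈ t y) ↔ ∀ y, R x y → φ ∈ typeAt Θ R V y := fun x φ => by
    constructor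
    · intro h y hxy
      obtain ⟨z, hxz, hz⟩ := hsee x y hxy
      exact hz ▸ h z hxz
    · intro h y hxy
      obtain ⟨z, hyz, hz⟩ := ht y
      exact hz ▸ h z (rel_of_reflGen_right hR hxy hyz)
  induction φ generalizing x with
  | var n => exact hV' n hφ x
  | bot =>
    obtain ⟨y, -, hy⟩ := ht x
    simp [hy, mem_typeAt, Sat]
  | top =>
    obtain ⟨y, -, hy⟩ := ht x
    simp [hy, mem_typeAt, Sat, hφ]
  | and φ ψ ihφ ihψ =>
    have h₁ : φ ∈ Θ := hΘ _ hφ (by simp [ClmFrm.subformulas, φ.self_mem_subformulas])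
    have h₂ : ψ ∈ Θ := hΘ _ hφ (by simp [ClmFrm.subformulas, ψ.self_mem_subformulas])
    obtain ⟨y, -, hy⟩ := ht x
    simp [Sat, ihφ h₁, ihψ h₂, hy, mem_typeAt, hφ, h₁, h₂]
  | neg φ ih =>
    have h₁ : φ ∈ Θ := hΘ _ hφ (by simp [ClmFrm.subformulas, φ.self_mem_subformulas])
    obtain ⟨y, -, hy⟩ := ht x
    simp [Sat, ih h₁, hy, mem_typeAt, hφ, h₁]
  | box φ ih =>
    have h₁ : φ ∈ Θ := hΘ _ hφ (by simp [ClmFrm.subformulas, φ.self_mem_subformulas])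
    simp only [Sat, ih h₁, hall]
    by_cases hx : IsFinal R (typeAt Θ R V) x
    · simp [ht_fin x hx, mem_typeAt, hφ, h₁, Sat]
    · rw [ht_box x hx φ hφ]
      -- A non-final point sees a point of its own type, so quantifying over `R` or over its
      -- reflexive closure makes no difference.
      refine ⟨fun h y hxy => ?_, fun h y hxy => h y (.single hxy)⟩
      rcases (Relation.reflGen_iff R x y).1 hxy with rfl | hxy
      · obtain ⟨z, hxz, hz, -⟩ := hfin _ hx
        exact hz ▸ h z hxz
      · exact h y hxy

end Types

/-- The questions about a point that determine its new type: `(s, true)` says that the type `s`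
is not visible, `(s, false)` that every point above it from which `s` is visible has type `s`. -/
abbrev Query : Type := Finset ClmFrm × Bool

open Classical in
/-- The new type of a point at which exactly the queries in `A` are answered positively. -/
noncomputable def newType (Θ : Finset ClmFrm) (A : Finset Query) : Finset ClmFrm :=
  -- The first case detects a final point. The second picks a visible type whose boxes agree with
  -- all visible types. The choice depends on `A` alone, which makes the new type definable from the
  -- queries.
  if h : ∃ s ∈ Θ.powerset, (s, true) ∉ A ∧ (s, false) ∈ A then h.choose
  else if h : ∃ s ∈ Θ.powerset, (s, true) ∉ A ∧ ∀ φ, ClmFrm.box φ ∈ Θ →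
      (ClmFrm.box φ ∈ s ↔ ∀ u ∈ Θ.powerset, (u, true) ∉ A → φ ∈ u) then h.choose
  else ∅

section NewType

variable {W : Type} {R : W → W → Prop} {V : ℕ → Set W} {Θ : Finset ClmFrm} {A : Finset Query}
  {x : W}

/-- `A` is the set of queries over `Θ` answered positively at `x`. -/
def Answers (Θ : Finset ClmFrm) (R : W → W → Prop) (V : ℕ → Set W) (x : W)
    (A : Finset Query) : Prop :=
  ∀ s ∈ Θ.powerset,
    ((s, true) ∈ A ↔ ∀ y, Relation.ReflGen R x y → typeAt Θ R V y ≠ s) ∧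
    ((s, false) ∈ A ↔ ∀ y, Relation.ReflGen R x y →
      (∃ z, Relation.ReflGen R y z ∧ typeAt Θ R V z = s) → typeAt Θ R V y = s)

theorem typeAt_mem_powerset (y : W) : typeAt Θ R V y ∈ Θ.powerset := by
  simp [typeAt]

theorem Answers.eq_of_mem (hA : Answers Θ R V x A) {s : Finset ClmFrm} (hs : s ∈ Θ.powerset)
    (h₁ : (s, true) ∉ A) (h₂ : (s, false) ∈ A) :
    s = typeAt Θ R V x ∧ IsFinal R (typeAt Θ R V) x := by
  rw [(hA s hs).1] at h₁
  rw [(hA s hs).2] at h₂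
  push Not at h₁
  obtain rfl := h₂ x .refl h₁
  exact ⟨rfl, h₂⟩

theorem newType_of_isFinal (hA : Answers Θ R V x A) (hx : IsFinal R (typeAt Θ R V) x) :
    newType Θ A = typeAt Θ R V x := by
  have h : ∃ s ∈ Θ.powerset, (s, true) ∉ A ∧ (s, false) ∈ A := by
    refine ⟨_, typeAt_mem_powerset (R := R) (V := V) x, ?_, ?_⟩
    · rw [(hA _ (typeAt_mem_powerset (R := R) (V := V) x)).1]
      exact fun h => h x .refl rfl
    · rwa [(hA _ (typeAt_mem_powerset (R := R) (V := V) x)).2]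
  rw [newType, dif_pos h]
  exact (hA.eq_of_mem h.choose_spec.1 h.choose_spec.2.1 h.choose_spec.2.2).1

theorem newType_of_not_isFinal (hΘ : SubformulaClosed Θ)
    (hA : Answers Θ R V x A) (hx : ¬ IsFinal R (typeAt Θ R V) x)
    (hfin : ∃ y, R x y ∧ typeAt Θ R V y = typeAt Θ R V x) :
    (∃ y, Relation.ReflGen R x y ∧ newType Θ A = typeAt Θ R V y) ∧
      ∀ φ, ClmFrm.box φ ∈ Θ → (ClmFrm.box φ ∈ newType Θ A ↔
        ∀ y, Relation.ReflGen R x y → φ ∈ typeAt Θ R V y) := by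
  have h₁ : ¬ ∃ s ∈ Θ.powerset, (s, true) ∉ A ∧ (s, false) ∈ A := by
    rintro ⟨s, hs, h₁, h₂⟩
    exact hx (hA.eq_of_mem hs h₁ h₂).2
  have hvis : ∀ s ∈ Θ.powerset,
      ((s, true) ∉ A ↔ ∃ y, Relation.ReflGen R x y ∧ s = typeAt Θ R V y) := fun s hs => by
    rw [(hA s hs).1]
    push Not
    simp only [eq_comm]
  have hbox : ∀ φ, (∀ u ∈ Θ.powerset, (u, true) ∉ A → φ ∈ u) ↔
      ∀ y, Relation.ReflGen R x y → φ ∈ typeAt Θ R V y := fun φ => by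
    constructor
    · exact fun h y hy => h _ (typeAt_mem_powerset y) ((hvis _ (typeAt_mem_powerset y)).2
        ⟨y, hy, rfl⟩)
    · intro h u hu hu'
      obtain ⟨y, hy, rfl⟩ := (hvis u hu).1 hu'
      exact h y hy
  have h₂ : ∃ s ∈ Θ.powerset, (s, true) ∉ A ∧ ∀ φ, ClmFrm.box φ ∈ Θ →
      (ClmFrm.box φ ∈ s ↔ ∀ u ∈ Θ.powerset, (u, true) ∉ A → φ ∈ u) := by
    -- The old type of `x` qualifies, because `x` sees a point of its own type.
    refine ⟨_, typeAt_mem_powerset (R := R) (V := V) x, (hvis _ (typeAt_mem_powerset (R := R) (V := V) x)).2 ⟨x, .refl, rfl⟩,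
      fun φ hφ => ?_⟩
    have hφ' : φ ∈ Θ := hΘ _ hφ (by simp [ClmFrm.subformulas, φ.self_mem_subformulas])
    rw [hbox]
    obtain ⟨z, hxz, hz⟩ := hfin
    constructor
    · intro h y hxy
      rw [mem_typeAt] at h
      rcases (Relation.reflGen_iff R x y).1 hxy with rfl | hxy
      · rw [← hz, mem_typeAt]
        exact ⟨hφ', h.2 z hxz⟩
      · exact mem_typeAt.2 ⟨hφ', h.2 y hxy⟩
    · exact fun h => mem_typeAt.2 ⟨hφ, fun y hxy => (mem_typeAt.1 (h y (.single hxy))).2⟩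
  rw [newType, dif_neg h₁, dif_pos h₂]
  refine ⟨(hvis _ h₂.choose_spec.1).1 h₂.choose_spec.2.1, fun φ hφ => ?_⟩
  rw [h₂.choose_spec.2.2 φ hφ, hbox]

end NewType

/-! ### The substitution -/

theorem exists_encoding (I : Finset Query) :
    ∃ (e : Query → ℕ) (d : ℕ → Query), ∀ q ∈ I, d (e q) = q := by
  obtain ⟨e, he⟩ := Set.countable_iff_exists_injOn.1 I.countable_toSet
  exact ⟨e, Function.invFunOn e I, he.leftInvOn_invFunOn⟩

/-- The formula characterizing the points of type `s`. -/
theorem exists_typeFormula (Θ s : Finset ClmFrm) :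
    ∃ χ : ClmFrm, ∀ (W : Type) (R : W → W → Prop) (V : ℕ → Set W) (w : W),
      Sat R V w χ ↔ typeAt Θ R V w = s := by
  obtain ⟨χ, -, h⟩ := exists_sat_iff id Θ (· = s)
  exact ⟨χ, h⟩

/-- The instances of the Grzegorczyk axiom for `¬χ`. -/
def grzInstance (χ : ClmFrm) : ClmFrm := grzAxiom.subst fun _ => .neg χ

/-- Contrapositive of Grz with `p` saying "not of this type": since `x` sees its own type, it sees a
point of that type above which the type, once left, never returns. -/
theorem exists_final {Θ : Finset ClmFrm} {U : Finset ClmFrm → ClmFrm}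
    (hU : ∀ (s : Finset ClmFrm) (W : Type) (R : W → W → Prop) (V : ℕ → Set W) (w : W),
      Sat R V w (U s) ↔ typeAt Θ R V w = s)
    {W : Type} {R : W → W → Prop} (hR : ∀ x y z, R x y → R y z → R x z) {V : ℕ → Set W}
    (h : ∀ s ∈ Θ.powerset, ∀ w, Sat R V w (grzInstance (U s))) {x : W}
    (hx : ¬ IsFinal R (typeAt Θ R V) x) :
    ∃ y, R x y ∧ typeAt Θ R V y = typeAt Θ R V x ∧ IsFinal R (typeAt Θ R V) y := by
  have hg := h _ (typeAt_mem_powerset (R := R) (V := V) x) x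
  simp only [grzInstance, grzAxiom, sat_subst, sat_imp, Sat, hU, Set.mem_ofPred_eq] at hg
  have hsee : ∃ z, R x z ∧ typeAt Θ R V z = typeAt Θ R V x := by
    unfold IsFinal at hx
    push Not at hx
    obtain ⟨y, hxy, ⟨z, hyz, hz⟩, hy⟩ := hx
    rcases (Relation.reflGen_iff R x y).1 hxy with rfl | hxy
    · exact absurd rfl hy
    · exact ⟨z, rel_of_reflGen_right hR hxy hyz, hz⟩
  obtain ⟨z, hxz, hz⟩ := hsee
  by_contra! hn
  refine hg (fun y hxy h₁ hy => hn y hxy hy ?_) z hxz hz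
  rintro v hyv ⟨u, hvu, hu⟩
  rcases (Relation.reflGen_iff R y v).1 hyv with rfl | hyv
  · rfl
  · by_contra hv
    rw [hy] at hv hu
    rcases (Relation.reflGen_iff R v u).1 hvu with rfl | hvu
    · exact hv hu
    · exact h₁ v hyv hv u hvu hu

/-- Over the relevant Grzegorczyk instances every rule with formulae in `Θ` is interderivable with
a substitution instance of a rule whose variables are replaced with Boolean combinations of
translations of variables. -/
theorem exists_substitution {Θ : Finset ClmFrm} (hΘ : SubformulaClosed Θ) :
    ∃ (s σ : ℕ → ClmFrm) (G : Finset ClmFrm), (∀ n, models (s n) ∈ combs) ∧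
      (∀ φ ∈ G, ∃ χ, φ = grzInstance χ) ∧
      ∀ φ ∈ Θ, GlobalConseq (insert φ G) ((φ.subst s).subst σ) ∧
        GlobalConseq (insert ((φ.subst s).subst σ) G) φ := by
  classical
  choose U hU using exists_typeFormula Θ
  let I : Finset Query := Θ.powerset ×ˢ Finset.univ
  obtain ⟨e, d, hd⟩ := exists_encoding I
  have hI : ∀ u ∈ Θ.powerset, ∀ b, d (e (u, b)) = (u, b) := fun u hu b =>
    hd _ (by simpa [I] using Finset.mem_powerset.1 hu)
  -- Each variable becomes a Boolean combination of formulae `T (var (e q))`, stating that it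
  -- belongs to the new type.
  choose s hs hs' using fun n => exists_sat_iff (fun q => ClmFrm.boxPlus (.var (e q))) I
    fun A => ClmFrm.var n ∈ newType Θ A
  -- Chosen so that `□⁺` of the image of `e q` is the positive answer to the query `q`: `□⁺¬U` for
  -- invisibility, `□⁺(◇⁺U → U)` for the second kind.
  let σ : ℕ → ClmFrm := fun n => if (d n).2 then .neg (U (d n).1) else
    .imp (.neg (.boxPlus (.neg (U (d n).1)))) (U (d n).1)
  refine ⟨s, σ, Θ.powerset.image fun u => grzInstance (U u), fun n => hs n combs fun q _ =>
    BooleanSubalgebra.subset_closure ⟨.var (e q), rfl⟩, by simp, fun φ hφ => ?_⟩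
  have key : ∀ (W : Type) (R : W → W → Prop), (∀ x y z, R x y → R y z → R x z) →
      ∀ V : ℕ → Set W, (∀ u ∈ Θ.powerset, ∀ w, Sat R V w (grzInstance (U u))) →
      ((∀ w, Sat R V w φ) ↔ ∀ w, Sat R V w ((φ.subst s).subst σ)) := by
    intro W R hR V hG
    have hfin := fun x => exists_final (x := x) hU hR hG
    let A : W → Finset Query := fun x =>
      {q ∈ I | Sat R (fun n => {v | Sat R V v (σ n)}) x (.boxPlus (.var (e q)))}
    have hA : ∀ x, Answers Θ R V x (A x) := by
      intro x u hu
      have hmem : ∀ b, (u, b) ∈ I := fun b => by simpa [I] using Finset.mem_powerset.1 hu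
      constructor
      · simp [A, hmem, sat_boxPlus, σ, hI u hu, hU, Sat]
      · simp [A, hmem, sat_boxPlus, σ, hI u hu, hU, Sat, sat_imp]
    let t : W → Finset ClmFrm := fun x => newType Θ (A x)
    have ht_fin : ∀ x, IsFinal R (typeAt Θ R V) x → t x = typeAt Θ R V x :=
      fun x hx => newType_of_isFinal (hA x) hx
    have ht_not := fun x (hx : ¬ IsFinal R (typeAt Θ R V) x) =>
      newType_of_not_isFinal hΘ (hA x) hx ((hfin x hx).imp fun y hy => ⟨hy.1, hy.2.1⟩)
    have ht : ∀ x, ∃ y, Relation.ReflGen R x y ∧ t x = typeAt Θ R V y := fun x => by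
      by_cases hx : IsFinal R (typeAt Θ R V) x
      · exact ⟨x, .refl, ht_fin x hx⟩
      · exact (ht_not x hx).1
    have hsat : ∀ x, Sat R V x ((φ.subst s).subst σ) ↔ φ ∈ t x := fun x => by
      rw [sat_subst, sat_subst]
      exact sat_recolour hΘ hR hfin ht ht_fin (fun x hx => (ht_not x hx).2)
        (fun n _ x => hs' n _ _ _ x) hφ x
    simp only [hsat]
    -- Pointwise truth may change, but global truth does not: every new type is an old one, and
    -- every old type is kept by some final point.
    constructor
    · intro h x
      obtain ⟨y, -, hy⟩ := ht x
      exact hy ▸ mem_typeAt.2 ⟨hφ, h y⟩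
    · intro h x
      refine (mem_typeAt (Θ := Θ).1 ?_).2
      by_cases hx : IsFinal R (typeAt Θ R V) x
      · exact ht_fin x hx ▸ h x
      · obtain ⟨y, -, hyx, hy⟩ := hfin x hx
        rw [← hyx, ← ht_fin y hy]
        exact h y
  constructor
  · intro W R hR V h
    simp only [Finset.forall_mem_insert, Finset.forall_mem_image] at h
    exact (key W R hR V h.2).1 h.1
  · intro W R hR V h
    simp only [Finset.forall_mem_insert, Finset.forall_mem_image] at h
    exact (key W R hR V h.2).2 h.1

/-! ### The interval theorem -/

section Interval

variable {L : RuleSystem SimFrm} {M : RuleSystem ClmFrm}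

theorem K4_le_tau : K4 ≤ tau L := Set.subset_union_left.trans (subset_generate _)

theorem tau_le_sigma : tau L ≤ sigma L := Set.subset_union_right.trans (subset_generate _)

theorem K4Grz_le_sigma : K4Grz ≤ sigma L := Set.subset_union_left.trans (subset_generate _)

theorem grzInstance_mem_sigma (χ : ClmFrm) : axiomRule (grzInstance χ) ∈ (sigma L).1 := by
  have h : axiomRule grzAxiom ∈ K4Grz.1 := subset_generate _ (.inr rfl)
  simpa [axiomRule] using! (sigma L).2.structurality (fun _ => .neg χ) _ _ (K4Grz_le_sigma h)

theorem mem_sigma_of_globalConseq {G Γ : Finset ClmFrm} {ψ : ClmFrm}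
    (hG : ∀ φ ∈ G, ∃ χ, φ = grzInstance χ) (h : GlobalConseq (G ∪ Γ) ψ) :
    (Γ, {ψ}) ∈ (sigma L).1 := by
  refine (sigma L).2.cut_premises
    (mem_of_globalConseq (K4_le_tau.trans tau_le_sigma) h) fun φ hφ => ?_
  obtain ⟨χ, rfl⟩ := hG φ hφ
  exact (sigma L).2.weaken (grzInstance_mem_sigma χ) (by simp) subset_rfl

/-- The substitution `s` carries the rule into `τL`; applying `σ` stays inside `σL` and, modulo
Grzegorczyk instances, restores the original rule. -/
theorem le_sigma (hM : IsMonomodalCompanion M L) : M ≤ sigma L := by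
  rintro ⟨Γ, Δ⟩ h
  obtain ⟨s, σ, G, hs, hG, hΘ⟩ := exists_substitution
    (Θ := (Γ ∪ Δ).biUnion ClmFrm.subformulas) fun φ hφ => by
      obtain ⟨ψ, hψ, hφ⟩ := Finset.mem_biUnion.1 hφ
      exact (ClmFrm.subformulas_subset hφ).trans (Finset.subset_biUnion_of_mem _ hψ)
  have hmem : ∀ φ ∈ Γ ∪ Δ, φ ∈ (Γ ∪ Δ).biUnion ClmFrm.subformulas := fun φ hφ =>
    Finset.mem_biUnion.2 ⟨φ, hφ, φ.self_mem_subformulas⟩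
  have h₁ := (sigma L).2.structurality σ _ _ (tau_le_sigma (subst_rule_mem_tau hM hs h))
  rw [Finset.image_image, Finset.image_image] at h₁
  simpa using (sigma L).2.image_mem (g := id) h₁
    (fun φ hφ => mem_sigma_of_globalConseq hG (by
      rw [Finset.union_comm]; exact (hΘ φ (hmem φ (Finset.mem_union_left _ hφ))).1))
    (fun φ hφ => mem_sigma_of_globalConseq hG (by
      rw [Finset.union_comm]; exact (hΘ φ (hmem φ (Finset.mem_union_right _ hφ))).2))

theorem tau_le (hM : IsMonomodalCompanion M L) : tau L ≤ M := by
  refine generate_le (Set.union_subset hM.1 ?_)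
  rintro _ ⟨r, hr, rfl⟩
  rw [hM.2] at hr
  exact hr

theorem isMonomodalCompanion_of_mem_Icc (hL : mHC ≤ L) (h₁ : tau L ≤ M) (h₂ : M ≤ sigma L) :
    IsMonomodalCompanion M L :=
  ⟨K4_le_tau.trans h₁, Set.Subset.antisymm
    (fun r hr => h₁ (subset_generate _ (.inr ⟨r, hr, rfl⟩)))
    fun _ hr => rho_sigma_subset hL (h₂ hr)⟩

end Interval

end IntervalThm

theorem mainTheorem6 (L : IntervalThm.RuleSystem IntervalThm.SimFrm)
    (hL : L ∈ IntervalThm.NExt IntervalThm.mHC) :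
    {M | IntervalThm.IsMonomodalCompanion M L} =
        Set.Icc (IntervalThm.tau L) (IntervalThm.sigma L) ∧
      IsLeast {M | IntervalThm.IsMonomodalCompanion M L} (IntervalThm.tau L) ∧
      IsGreatest {M | IntervalThm.IsMonomodalCompanion M L} (IntervalThm.sigma L) := by
  have h := IntervalThm.tau_le_sigma (L := L)
  have hIcc : {M | IntervalThm.IsMonomodalCompanion M L} =
      Set.Icc (IntervalThm.tau L) (IntervalThm.sigma L) := Set.ext fun M =>
    ⟨fun hM => ⟨IntervalThm.tau_le hM, IntervalThm.le_sigma hM⟩,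
      fun hM => IntervalThm.isMonomodalCompanion_of_mem_Icc hL hM.1 hM.2⟩
  rw [hIcc]
  exact ⟨rfl, isLeast_Icc h, isGreatest_Icc h⟩
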